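/- Let $G$ be a group. A $G$-automaton over a finite alphabet $\Sigma$ consists of a finite set of states with an initial state $q_1$ and a set of accept states, and a transition function $\delta$ assigning to each state and each $\sigma\in\Sigma\cup\{\varepsilon\}$ a finite set of pairs (state, element of $G$). If $(q',g)\in\delta(q,\sigma)$, the automaton in state $q$ may read $\sigma$ (nothing if $\sigma=\varepsilon$), move to $q'$, and replace the content $x\in G$ of its register by $xg$. It accepts a word $w$ if some computation starting in $q_1$ with register $1$ reads all of $w$ and ends in an accept state with register $1$. Let $\mathfrak L(G)$ be the class of all languages over finite alphabets recognized by $G$-automata, and let $\mathsf{CF}$ be the class of context-free languages. Then: 1. $\mathfrak L(SL(2,\mathbb Z))\subsetneq\mathfrak L(SL(2,\mathbb Q))$. 2. The unary language $\mathtt{UPOW_{odd}}=\{a^{2^{2n+1}}\mid n\ge 0\}$ is not regular and is recognized by the following $SL(2,\mathbb Q)$-automaton. Let $$A_1=\begin{pmatrix}2&0\\1&\frac12\end{pmatrix},\quad A_2=\begin{pmatrix}2&0\\0&\frac12\end{pmatrix},\quad A_3=\begin{pmatrix}1&0\\-1&1\end{pmatrix},\quad A_4=\begin{pmatrix}\frac12&0\\0&2\end{pmatrix}.$$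 The states are $0,1,2,3,4$, the initial state is $0$, the only accept state is $4$, and the transitions $q\xrightarrow{\sigma,\,g}q'$ are $$0\xrightarrow{\varepsilon,A_1}1,\quad 1\xrightarrow{\varepsilon,A_2}1,\quad 1\xrightarrow{\varepsilon,I}2,\quad 2\xrightarrow{a,A_3}2,\quad 2\xrightarrow{\varepsilon,I}3,\quad 3\xrightarrow{\varepsilon,A_4}3,\quad 3\xrightarrow{\varepsilon,I}4.$$ 3. $\mathfrak L(SL(2,\mathbb Z))=\mathsf{CF}$, and every language over a one-letter alphabet in $\mathfrak L(SL(2,\mathbb Z))$ is regular. -/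

import Mathlib

/-- `SL(2,ℤ)`. -/
abbrev SLTwoInt : Type := Matrix.SpecialLinearGroup (Fin 2) ℤ

/-- `SL(2,ℚ)`. -/
abbrev SLTwoRat : Type := Matrix.SpecialLinearGroup (Fin 2) ℚ

/-- An extended finite automaton over the group `G` (a `G`-automaton) with input alphabet `A`:
finitely many states, and finitely many transitions, each consuming an input symbol (`some a`) or
nothing (`none`), changing the state, and multiplying the register on the right by an element
of `G`. -/
structure GroupAutomaton (A G : Type) [Group G] where
  /-- The states. -/
  Q : Type
  finite_Q : Finite Q
  /-- The transition function. -/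
  step : Q → Option A → Finset (Q × G)
  /-- The initial state. -/
  start : Q
  /-- The accept states. -/
  accept : Set Q

namespace GroupAutomaton

variable {A G : Type} [Group G]

/-- One step between configurations (state, unread input, register). -/
inductive Step (E : GroupAutomaton A G) : E.Q × List A × G → E.Q × List A × G → Prop
  | eps {q q' : E.Q} {g : G} (w : List A) (x : G) (h : (q', g) ∈ E.step q none) :
      Step E (q, w, x) (q', w, x * g)
  | read {q q' : E.Q} {g : G} (a : A) (w : List A) (x : G) (h : (q', g) ∈ E.step q (some a)) :
      Step E (q, a :: w, x) (q', w, x * g)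

/-- The language recognized by `E`: the words `w` for which some computation that starts in the
initial state with the register equal to `1` reads all of `w` and ends in an accept state with the
register equal to `1`. -/
def language (E : GroupAutomaton A G) : Language A :=
  {w | ∃ q ∈ E.accept, Relation.ReflTransGen E.Step (E.start, w, 1) (q, [], 1)}

end GroupAutomaton

/-- A language together with its finite alphabet. -/
structure FormalLanguage where
  /-- The alphabet. -/
  alphabet : Type
  finite_alphabet : Finite alphabet
  /-- The set of words. -/
  words : Language alphabet

/-- The class of the languages, over arbitrary finite alphabets, recognized by `G`-automata. -/
def languageClass (G : Type) [Group G] : Set FormalLanguage :=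
  {L | ∃ E : GroupAutomaton L.alphabet G, E.language = L.words}

/-- The class of the context-free languages over arbitrary finite alphabets. -/
def contextFreeClass : Set FormalLanguage :=
  {L | L.words.IsContextFree}

/-- The unary language of the words of length `2 ^ (2 * n + 1)`, `n ≥ 0`; the letter is `()`. -/
def UPOWodd : Language Unit :=
  {w | ∃ n : ℕ, w = List.replicate (2 ^ (2 * n + 1)) ()}

namespace UPOWodd

/-- The matrix that initializes the register. -/
def A₁ : SLTwoRat := ⟨!![2, 0; 1, 1 / 2], by norm_num [Matrix.det_fin_two_of]⟩

/-- The matrix used repeatedly before reading the input. -/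
def A₂ : SLTwoRat := ⟨!![2, 0; 0, 1 / 2], by norm_num [Matrix.det_fin_two_of]⟩

/-- The matrix used for each letter read. -/
def A₃ : SLTwoRat := ⟨!![1, 0; -1, 1], by norm_num [Matrix.det_fin_two_of]⟩

/-- The matrix used repeatedly after reading the input. -/
def A₄ : SLTwoRat := ⟨!![1 / 2, 0; 0, 2], by norm_num [Matrix.det_fin_two_of]⟩

/-- The transition function of the automaton below. -/
def delta : Fin 5 → Option Unit → Finset (Fin 5 × SLTwoRat)
  | 0, none => {(1, A₁)}
  | 1, none => {(1, A₂), (2, 1)}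
  | 2, some () => {(2, A₃)}
  | 2, none => {(3, 1)}
  | 3, none => {(3, A₄), (4, 1)}
  | _, _ => ∅

/-- The `SL(2,ℚ)`-automaton for `UPOWodd`, with states `0, 1, 2, 3, 4`. -/
def automaton : GroupAutomaton Unit SLTwoRat where
  Q := Fin 5
  finite_Q := inferInstance
  step := delta
  start := 0
  accept := {4}

end UPOWodd

/-! The crux is that `SL(2,ℤ)` recognizes exactly the context-free languages. Over one letter these
are regular, whereas `UPOWodd` is not regular and is recognized over `SL(2,ℚ)`; with the embedding
of `SL(2,ℤ)` into `SL(2,ℚ)` this gives the strict inclusion.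

From grammars to automata: `SL(2,ℤ)` contains a free group of infinite rank (`freeRep_injective`),
and a free group can hold a stack: push multiplies by a generator, pop by its inverse. A register
also allows a pop before its push, but the states of `pushdown` exclude cancellations in that order
(`ContextFreeGrammar.CutRun.exists_stackMove`). So a trivial register forces properly nested pushes
and pops, that is, a derivation.

From automata to grammars: `SL(2,ℤ)` is the amalgam of cyclic groups of orders 4 and 6 over `±1`.
Every register change is a product of elements of these finite groups, and a nonempty alternating
product is never central (`Alternating.prod_notMem_centralPart`). Hence merging adjacent pieces from
the same factor collapses any computation with trivial product, each intermediate product staying in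
a finite set (`HasNormalForm.cut_mul`). A grammar with nonterminals (point, element of that set,
point) records these mergings.

Unary languages: a long yield needs a nonterminal that reproduces itself with a context of positive
length, so the set of lengths is eventually closed under adding a fixed period (`exists_period`),
hence eventually periodic. -/

/-! ### Derivations as parse forests -/

namespace ContextFreeGrammar

variable {T : Type*} {g : ContextFreeGrammar T}

/-- `g.Yields s w`: the sentential form `s` derives the terminal word `w`, with the derivation
organized as a forest of parse trees. -/
inductive Yields (g : ContextFreeGrammar T) : List (Symbol T g.NT) → List T → Prop
  | nil : Yields g [] []
  | terminal (a : T) {s : List (Symbol T g.NT)} {w : List T} (h : Yields g s w) :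
      Yields g (.terminal a :: s) (a :: w)
  | nonterminal {r : ContextFreeRule T g.NT} {s : List (Symbol T g.NT)} {u w : List T}
      (hr : r ∈ g.rules) (h₁ : Yields g r.output u) (h₂ : Yields g s w) :
      Yields g (.nonterminal r.input :: s) (u ++ w)

lemma Yields.derives {s : List (Symbol T g.NT)} {w : List T} (h : g.Yields s w) :
    g.Derives s (w.map Symbol.terminal) := by
  induction h with
  | nil => exact .refl _
  | terminal a _ ih => simpa using ih.append_left [Symbol.terminal a]
  | @nonterminal r s u w hr _ _ ih₁ ih₂ =>
    have h₁ : g.Produces (.nonterminal r.input :: s) (r.output ++ s) := ⟨r, hr, .head s⟩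
    rw [List.map_append]
    exact h₁.trans_derives ((ih₁.append_right s).trans (ih₂.append_left _))

lemma Yields.append {s t : List (Symbol T g.NT)} {u v : List T} (hs : g.Yields s u)
    (ht : g.Yields t v) : g.Yields (s ++ t) (u ++ v) := by
  induction hs with
  | nil => exact ht
  | terminal a _ ih => exact .terminal a ih
  | nonterminal hr h₁ _ _ ih =>
    rw [List.append_assoc]
    exact .nonterminal hr h₁ ih

lemma Yields.exists_of_append {s t : List (Symbol T g.NT)} {w : List T}
    (h : g.Yields (s ++ t) w) : ∃ u v, w = u ++ v ∧ g.Yields s u ∧ g.Yields t v := by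
  induction s generalizing w with
  | nil => exact ⟨[], w, rfl, .nil, h⟩
  | cons x s ih =>
    cases h with
    | terminal a h =>
      obtain ⟨u, v, rfl, hu, hv⟩ := ih h
      exact ⟨a :: u, v, rfl, .terminal a hu, hv⟩
    | nonterminal hr h₁ h₂ =>
      obtain ⟨u, v, rfl, hu, hv⟩ := ih h₂
      exact ⟨_ ++ u, v, by simp, .nonterminal hr h₁ hu, hv⟩

lemma yields_map_terminal (w : List T) : g.Yields (w.map Symbol.terminal) w := by
  induction w with
  | nil => exact .nil
  | cons a w ih => exact .terminal a ih

lemma Yields.of_produces {s t : List (Symbol T g.NT)} {w : List T} (hst : g.Produces s t)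
    (h : g.Yields t w) : g.Yields s w := by
  obtain ⟨r, hr, hrw⟩ := hst
  obtain ⟨p, q, rfl, rfl⟩ := hrw.exists_parts
  obtain ⟨_, v, rfl, h', hv⟩ := h.exists_of_append
  obtain ⟨u, m, rfl, hu, hm⟩ := h'.exists_of_append
  refine (hu.append ?_).append hv
  simpa using Yields.nonterminal hr hm .nil

/-- Parse forests pull back along each production, starting from the terminal word at the end of the
derivation. -/
lemma mem_language_iff_yields {w : List T} :
    w ∈ g.language ↔ g.Yields [.nonterminal g.initial] w := by
  rw [mem_language_iff]
  refine ⟨fun h => ?_, Yields.derives⟩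
  generalize [Symbol.nonterminal g.initial] = s at h
  induction h using Relation.ReflTransGen.head_induction_on with
  | refl => exact yields_map_terminal w
  | head h _ ih => exact .of_produces h ih

/-- The words denoted by a sentential form, when each nonterminal `A` denotes the words satisfying
`sem A`. -/
def Denotes {N : Type*} (sem : N → List T → Prop) : List (Symbol T N) → List T → Prop
  | [], w => w = []
  | .terminal a :: s, w => ∃ v, w = a :: v ∧ Denotes sem s v
  | .nonterminal A :: s, w => ∃ u v, w = u ++ v ∧ sem A u ∧ Denotes sem s v

/-- An interpretation of the nonterminals that is closed under the rules contains everything the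
grammar derives. -/
lemma Yields.denotes {sem : g.NT → List T → Prop}
    (hsem : ∀ r ∈ g.rules, ∀ w, Denotes sem r.output w → sem r.input w)
    {s : List (Symbol T g.NT)} {w : List T} (h : g.Yields s w) : Denotes sem s w := by
  induction h with
  | nil => rfl
  | terminal a _ ih => exact ⟨_, rfl, ih⟩
  | nonterminal hr _ _ ih₁ ih₂ => exact ⟨_, _, rfl, hsem _ hr _ ih₁, ih₂⟩

end ContextFreeGrammar

/-! ### Computations as labelled paths -/

namespace GroupAutomaton

variable {A G : Type} [Group G] {E : GroupAutomaton A G}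

/-- `E.Run q w g q'`: some computation from `q` to `q'` reads `w` and multiplies the register
by `g`. -/
inductive Run (E : GroupAutomaton A G) : E.Q → List A → G → E.Q → Prop
  | nil (q : E.Q) : Run E q [] 1 q
  | eps {q q' q'' : E.Q} {g h : G} {w : List A} (hs : (q', g) ∈ E.step q none)
      (hr : Run E q' w h q'') : Run E q w (g * h) q''
  | read {q q' q'' : E.Q} {g h : G} {w : List A} (a : A) (hs : (q', g) ∈ E.step q (some a))
      (hr : Run E q' w h q'') : Run E q (a :: w) (g * h) q''

lemma Run.trans {q q' q'' : E.Q} {u v : List A} {g h : G} (h₁ : E.Run q u g q')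
    (h₂ : E.Run q' v h q'') : E.Run q (u ++ v) (g * h) q'' := by
  induction h₁ with
  | nil q => simpa using h₂
  | eps hs _ ih => rw [mul_assoc]; exact .eps hs (ih h₂)
  | read a hs _ ih => rw [mul_assoc]; exact .read a hs (ih h₂)

lemma Run.of_mem_step {q q' : E.Q} {σ : Option A} {g : G} (h : (q', g) ∈ E.step q σ) :
    E.Run q σ.toList g q' := by
  cases σ with
  | none => simpa using Run.eps h (.nil q')
  | some a => simpa using Run.read a h (.nil q')

lemma Run.reflTransGen {q q' : E.Q} {w : List A} {g : G} (h : E.Run q w g q') (x : G) :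
    Relation.ReflTransGen E.Step (q, w, x) (q', [], x * g) := by
  induction h generalizing x with
  | nil q => simpa using Relation.ReflTransGen.refl
  | eps hs _ ih => exact .head (.eps _ _ hs) (by simpa [mul_assoc] using ih (x * _))
  | read a hs _ ih => exact .head (.read a _ _ hs) (by simpa [mul_assoc] using ih (x * _))

lemma run_of_reflTransGen {c : E.Q × List A × G} {q' : E.Q} {y : G}
    (h : Relation.ReflTransGen E.Step c (q', [], y)) : E.Run c.1 c.2.1 (c.2.2⁻¹ * y) q' := by
  induction h using Relation.ReflTransGen.head_induction_on with
  | refl => simpa using Run.nil q'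
  | head h _ ih =>
    cases h with
    | eps w x hs => simpa [mul_assoc] using Run.eps hs ih
    | read a w x hs => simpa [mul_assoc] using Run.read a hs ih

lemma mem_language_iff_run {w : List A} :
    w ∈ E.language ↔ ∃ q ∈ E.accept, E.Run E.start w 1 q := by
  refine exists_congr fun q => and_congr_right fun _ => ⟨fun h => ?_, fun h => ?_⟩
  · simpa using run_of_reflTransGen h
  · simpa using h.reflTransGen 1

end GroupAutomaton

/-! ### A free subgroup of infinite rank in `SL(2,ℤ)` -/

/-- The matrix of the Möbius transformation `z ↦ a - 1 / (z - b)`, which maps the outside of the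
unit disc centred at `b` into the unit disc centred at `a`. -/
def discSwap (a b : ℤ) : SLTwoInt :=
  ⟨!![a, -a * b - 1; 1, -b], by rw [Matrix.det_fin_two_of]; ring⟩

/-- `(p, q)`, as a point `p / q` of the projective line, lies in the unit disc centred at `a`. -/
def InDisc (a : ℤ) (v : Fin 2 → ℤ) : Prop :=
  |v 0 - a * v 1| ≤ |v 1| ∧ v 1 ≠ 0

/-- The image differs from `a` by `-1 / (z - b)`, which has absolute value below 1 when `|z - b| >
1`. The point at infinity, `v 1 = 0`, goes to the centre `a`. -/
lemma inDisc_discSwap_mulVec {a b : ℤ} {v : Fin 2 → ℤ} (hv : v ≠ 0) (hb : ¬ InDisc b v) :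
    InDisc a ((discSwap a b).1.mulVec v) := by
  have h0 : (discSwap a b).1.mulVec v 0 = a * v 0 + (-a * b - 1) * v 1 := by
    simp [discSwap, Matrix.mulVec, dotProduct, Fin.sum_univ_two]
  have h1 : (discSwap a b).1.mulVec v 1 = v 0 - b * v 1 := by
    simp [discSwap, Matrix.mulVec, dotProduct, Fin.sum_univ_two]; ring
  unfold InDisc
  rw [h0, h1, show a * v 0 + (-a * b - 1) * v 1 - a * (v 0 - b * v 1) = - v 1 by ring, abs_neg]
  by_cases hq : v 1 = 0
  · refine ⟨by simp [hq], fun h => hv ?_⟩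
    ext i
    fin_cases i
    · simpa [hq] using h
    · exact hq
  · have h := lt_of_not_ge fun h => hb ⟨h, hq⟩
    refine ⟨h.le, fun h' => ?_⟩
    rw [h', abs_zero] at h
    exact absurd h (not_lt.2 (abs_nonneg _))

/-- Up to a sign, invisible on the projective line, inverting exchanges the two centres. -/
lemma inDisc_discSwap_inv_mulVec {a b : ℤ} {v : Fin 2 → ℤ} (hv : v ≠ 0) (ha : ¬ InDisc a v) :
    InDisc b ((discSwap a b)⁻¹.1.mulVec v) := by
  have h : (discSwap a b)⁻¹ = -discSwap b a := by
    refine inv_eq_of_mul_eq_one_right (Subtype.ext ?_)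
    change (discSwap a b).1 * -(discSwap b a).1 = 1
    ext i j
    fin_cases i <;> fin_cases j <;>
      (simp [discSwap, Matrix.mul_apply, Fin.sum_univ_two]; try ring)
  have hb := inDisc_discSwap_mulVec (a := b) hv ha
  rw [h, Matrix.SpecialLinearGroup.coe_neg, Matrix.neg_mulVec]
  refine ⟨?_, neg_ne_zero.2 hb.2⟩
  rw [Pi.neg_apply, Pi.neg_apply, mul_neg, ← neg_sub', abs_neg, abs_neg]
  exact hb.1

/-- Unit discs that meet have centres at distance at most 2, but distinct centres congruent mod 3
are at least 3 apart. -/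
lemma InDisc.eq_of_modEq {a b : ℤ} {v : Fin 2 → ℤ} (ha : InDisc a v) (hb : InDisc b v)
    (hab : a ≡ b [ZMOD 3]) : a = b := by
  by_contra hne
  have h3 : (3 : ℤ) ≤ |a - b| := by
    obtain ⟨k, hk⟩ := hab.symm.dvd
    rw [hk, abs_mul]
    have : k ≠ 0 := fun h => hne (by rw [h] at hk; linarith)
    have := Int.one_le_abs this
    norm_num
    linarith
  have hpos := abs_pos.2 ha.2
  have : |a - b| * |v 1| ≤ 2 * |v 1| := by
    rw [← abs_mul]
    calc |(a - b) * v 1| = |(v 0 - b * v 1) - (v 0 - a * v 1)| := by ring_nf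
      _ ≤ |v 0 - b * v 1| + |v 0 - a * v 1| := abs_sub _ _
      _ ≤ 2 * |v 1| := by linarith [ha.1, hb.1]
  nlinarith

/-- The centre of the disc attached to a letter of the free group on `ℕ`. -/
def discCenter (x : ℕ × Bool) : ℤ := 3 * (2 * x.1 + x.2.toNat)

lemma discCenter_injective : Function.Injective discCenter := by
  rintro ⟨m, b⟩ ⟨n, c⟩ h
  cases b <;> cases c <;> simp [discCenter] at h ⊢ <;> omega

/-- A faithful representation in `SL(2,ℤ)` of the free group of countable rank. -/
def freeRep : FreeGroup ℕ →* SLTwoInt :=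
  FreeGroup.lift fun n => discSwap (discCenter (n, true)) (discCenter (n, false))

lemma inDisc_letter_mulVec {x : ℕ × Bool} {v : Fin 2 → ℤ} (hv : v ≠ 0)
    (h : ¬ InDisc (discCenter (x.1, !x.2)) v) :
    InDisc (discCenter x) ((freeRep (FreeGroup.mk [x])).1.mulVec v) := by
  obtain ⟨n, b⟩ := x
  cases b
  · simpa [freeRep] using inDisc_discSwap_inv_mulVec hv h
  · simpa [freeRep] using inDisc_discSwap_mulVec hv h

/-- Ping-pong from the point at infinity, which lies in no disc. Each letter maps everything outside
the disc of its inverse into its own disc; reducedness and disjointness of the discs keep the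
current point outside the bad one. -/
lemma inDisc_freeRep_mulVec {x : ℕ × Bool} {l : List (ℕ × Bool)}
    (h : FreeGroup.IsReduced (x :: l)) :
    InDisc (discCenter x) ((freeRep (FreeGroup.mk (x :: l))).1.mulVec ![1, 0]) := by
  induction l generalizing x with
  | nil => exact inDisc_letter_mulVec (by simp) (by simp [InDisc])
  | cons y l ih =>
    rw [FreeGroup.isReduced_cons_cons] at h
    have hy := ih h.2
    have hmul : freeRep (FreeGroup.mk (x :: y :: l)) =
        freeRep (FreeGroup.mk [x]) * freeRep (FreeGroup.mk (y :: l)) := by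
      rw [← map_mul, FreeGroup.mul_mk, List.singleton_append]
    rw [hmul, Matrix.SpecialLinearGroup.coe_mul, ← Matrix.mulVec_mulVec]
    refine inDisc_letter_mulVec (fun h0 => hy.2 (by rw [h0]; rfl)) fun h' => ?_
    have he := discCenter_injective (h'.eq_of_modEq hy ?_)
    · have := h.1 (by rw [← he])
      rw [← he] at this
      simp at this
    · simp [discCenter, Int.ModEq]

lemma freeRep_injective : Function.Injective freeRep := by
  rw [injective_iff_map_eq_one]
  intro x hx
  rw [← FreeGroup.mk_toWord (x := x)] at hx ⊢
  have hred := FreeGroup.isReduced_toWord (x := x)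
  cases hl : x.toWord with
  | nil => rfl
  | cons y l =>
    rw [hl] at hx hred
    have h := (inDisc_freeRep_mulVec hred).2
    rw [hx] at h
    simp at h

/-! ### Context-free languages are recognized over `SL(2,ℤ)` -/

namespace ContextFreeGrammar

variable {T : Type} (g : ContextFreeGrammar T)

/-- The suffixes of the right-hand sides and of the initial form: the states of the pushdown
automaton of `g`, and also its stack symbols. -/
def suffixForms : Set (List (Symbol T g.NT)) :=
  {s | s <:+ [.nonterminal g.initial] ∨ ∃ r ∈ g.rules, s <:+ r.output}

lemma finite_suffixForms : g.suffixForms.Finite := by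
  have hfin (t : List (Symbol T g.NT)) : {s | s <:+ t}.Finite :=
    (List.finite_toSet t.tails).subset fun s hs => by simpa using hs
  refine (hfin _).union (?_ : {s | ∃ r ∈ g.rules, s <:+ r.output}.Finite)
  have := g.rules.finite_toSet.biUnion fun r _ => hfin r.output
  refine this.subset fun s ⟨r, hr, hs⟩ => ?_
  simpa using ⟨r, hr, hs⟩

variable {g}

lemma suffixForms_of_suffix {s t : List (Symbol T g.NT)} (ht : t ∈ g.suffixForms) (h : s <:+ t) :
    s ∈ g.suffixForms :=
  ht.imp h.trans fun ⟨r, hr, hr'⟩ => ⟨r, hr, h.trans hr'⟩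

variable (g) in
lemma nil_mem_suffixForms : [] ∈ g.suffixForms := .inl (List.nil_suffix)

lemma output_mem_suffixForms {r : ContextFreeRule T g.NT} (hr : r ∈ g.rules) :
    r.output ∈ g.suffixForms := .inr ⟨r, hr, List.suffix_rfl⟩

variable {G : Type} [Group G] (f : FreeGroup g.suffixForms →* G)

/-- The transitions of `pushdown`. -/
def pushdownStep (p : g.suffixForms) (σ : Option T) : Set (g.suffixForms × G) :=
  {x | (∃ a, σ = some a ∧ p.1 = .terminal a :: x.1.1 ∧ x.2 = 1) ∨
    (σ = none ∧ ∃ r ∈ g.rules, ∃ s : g.suffixForms, p.1 = .nonterminal r.input :: s.1 ∧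
      x.1.1 = r.output ∧ x.2 = f (FreeGroup.mk [(s, true)])) ∨
    (σ = none ∧ p.1 = [] ∧ x.2 = f (FreeGroup.mk [(x.1, false)]))}

lemma finite_pushdownStep (p : g.suffixForms) (σ : Option T) : (pushdownStep f p σ).Finite := by
  have : Finite g.suffixForms := g.finite_suffixForms
  refine (Set.finite_range fun y : g.suffixForms × Option (g.suffixForms × Bool) =>
    (y.1, f (FreeGroup.mk y.2.toList))).subset ?_
  rintro ⟨q, x⟩ (⟨a, -, -, rfl⟩ | ⟨-, r, -, s, -, -, rfl⟩ | ⟨-, -, h⟩)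
  · exact ⟨(q, none), by simp [← FreeGroup.one_eq_mk]⟩
  · exact ⟨(q, some (s, true)), rfl⟩
  · exact ⟨(q, some (q, false)), Prod.ext rfl h.symm⟩

/-- The pushdown automaton of `g`, whose stack is kept in a free subgroup of `G`: it stores the
remaining part of the current right-hand side in its state, pushes that part when it expands a
nonterminal, and pops it when the expansion is finished. -/
noncomputable def pushdown : GroupAutomaton T G where
  Q := g.suffixForms
  finite_Q := g.finite_suffixForms
  step p σ := (finite_pushdownStep f p σ).toFinset
  start := ⟨[.nonterminal g.initial], .inl List.suffix_rfl⟩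
  accept := {⟨[], g.nil_mem_suffixForms⟩}

lemma mem_pushdown_step {p : g.suffixForms} {σ : Option T} {x : g.suffixForms × G} :
    x ∈ (pushdown f).step p σ ↔ x ∈ pushdownStep f p σ :=
  Set.Finite.mem_toFinset _

/-- Expanding a nonterminal pushes the remainder `t`, consumes the right-hand side down to the empty
state, and pops `t`; the two register changes cancel. -/
lemma Yields.pushdown_run {u : List (Symbol T g.NT)} {w : List T} (h : g.Yields u w)
    (p q : g.suffixForms) (hp : p.1 = u ++ q.1) : (pushdown f).Run p w 1 q := by
  induction h generalizing p q with
  | nil =>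
    obtain rfl : p = q := Subtype.ext hp
    exact .nil (E := pushdown f) p
  | @terminal a s w _ ih =>
    have hs : s ++ q.1 ∈ g.suffixForms :=
      suffixForms_of_suffix p.2 (hp ▸ List.suffix_cons _ _)
    rw [← one_mul (1 : G)]
    exact .read (E := pushdown f) a
      ((mem_pushdown_step f (x := (⟨_, hs⟩, 1))).2 (.inl ⟨a, rfl, hp, rfl⟩)) (ih _ _ rfl)
  | @nonterminal r s u w hr _ _ ih₁ ih₂ =>
    let t : g.suffixForms := ⟨s ++ q.1, suffixForms_of_suffix p.2 (hp ▸ List.suffix_cons _ _)⟩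
    let o : g.suffixForms := ⟨r.output, output_mem_suffixForms hr⟩
    let e : g.suffixForms := ⟨[], g.nil_mem_suffixForms⟩
    have h₁ := ih₁ o e (by simp [o, e])
    have h₂ := ih₂ t q rfl
    have hpop : (pushdown f).Run e w (f (FreeGroup.mk [(t, false)]) * 1) q :=
      .eps ((mem_pushdown_step f).2 (.inr (.inr ⟨rfl, rfl, rfl⟩))) h₂
    have hpush : (pushdown f).Run p (u ++ w)
        (f (FreeGroup.mk [(t, true)]) * (1 * (f (FreeGroup.mk [(t, false)]) * 1))) q :=
      .eps (q' := o) ((mem_pushdown_step f).2 (.inr (.inl ⟨rfl, r, hr, t, hp, rfl, rfl⟩)))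
        (h₁.trans hpop)
    convert hpush using 1
    have : FreeGroup.mk [(t, true), (t, false)] = 1 :=
      Quot.sound (FreeGroup.Red.Step.cons_not (L := []) (b := true))
    simp [← map_mul, FreeGroup.mul_mk, this]

/-- A stack operation of `pushdown`: pushing `s` for the letter `(s, true)`, popping `s` for the
letter `(s, false)`. -/
def StackMove (p : List (Symbol T g.NT)) : g.suffixForms × Bool → List (Symbol T g.NT) → Prop
  | (s, true), q => ∃ r ∈ g.rules, p = .nonterminal r.input :: s.1 ∧ q = r.output
  | (s, false), q => p = [] ∧ q = s.1

/-- A computation of `pushdown` cut at the stack operations listed in the third argument; between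
them the state loses an initial part that derives the word read. -/
inductive CutRun (g : ContextFreeGrammar T) : List (Symbol T g.NT) → List T →
    List (g.suffixForms × Bool) → List (Symbol T g.NT) → Prop
  | nil {u q : List (Symbol T g.NT)} {w : List T} (h : g.Yields u w) : CutRun g (u ++ q) w [] q
  | cons {u p' p'' q : List (Symbol T g.NT)} {v w : List T} {x : g.suffixForms × Bool}
      {l : List (g.suffixForms × Bool)} (h : g.Yields u v) (hx : StackMove p' x p'')
      (ht : CutRun g p'' w l q) : CutRun g (u ++ p') (v ++ w) (x :: l) q

lemma CutRun.append_left {p q u : List (Symbol T g.NT)} {v w : List T}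
    {l : List (g.suffixForms × Bool)} (h : CutRun g p w l q) (hu : g.Yields u v) :
    CutRun g (u ++ p) (v ++ w) l q := by
  cases h with
  | nil h => rw [← List.append_assoc]; exact .nil (hu.append h)
  | cons h hx ht =>
    rw [← List.append_assoc, ← List.append_assoc]
    exact .cons (hu.append h) hx ht

/-- A stack operation can be put in front of a reduced cut computation, cancelling if need be.
A pop of `s` is never cancelled by a later push of `s`, because the state after the pop is `s`, and
`s` can be pushed only from a longer state. -/
lemma CutRun.exists_stackMove {p p' q : List (Symbol T g.NT)} {w : List T}
    {x : g.suffixForms × Bool} {l : List (g.suffixForms × Bool)} (hx : StackMove p x p')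
    (h : CutRun g p' w l q) (hl : FreeGroup.IsReduced l) :
    ∃ l', CutRun g p w l' q ∧ FreeGroup.IsReduced l' ∧
      FreeGroup.mk l' = FreeGroup.mk [x] * FreeGroup.mk l := by
  have hkeep : CutRun g p w (x :: l) q := by
    simpa using CutRun.cons (g := g) .nil hx h
  cases l with
  | nil => exact ⟨[x], hkeep, FreeGroup.IsReduced.singleton, by simp [FreeGroup.mul_mk]⟩
  | cons y l =>
    by_cases hxy : x.1 = y.1 → x.2 = y.2
    · exact ⟨x :: y :: l, hkeep, FreeGroup.isReduced_cons_cons.2 ⟨hxy, hl⟩,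
        by simp [FreeGroup.mul_mk]⟩
    push Not at hxy
    obtain ⟨s, b⟩ := x
    obtain ⟨t, c⟩ := y
    obtain ⟨rfl : s = t, hbc : b ≠ c⟩ := hxy
    cases h with
    | @cons u p₁ p₂ _ v w _ _ hu hy ht =>
      cases b <;> cases c <;> try exact absurd rfl hbc
      -- Pop followed by push: `s` would be a proper suffix of itself.
      · obtain ⟨-, hs⟩ := hx
        obtain ⟨r, -, rfl, -⟩ := hy
        have := congrArg List.length hs
        simp at this
        omega
      -- Push followed by pop: the pop happens in the empty state, so the whole right-hand side
      -- derived `v`, and the pair becomes a parse tree for the nonterminal.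
      · obtain ⟨r, hr, rfl, hu'⟩ := hx
        obtain ⟨rfl, rfl⟩ := hy
        refine ⟨l, ?_, (List.isChain_cons.1 hl).2, ?_⟩
        · have := Yields.nonterminal hr (by simpa [← hu'] using hu : g.Yields r.output v) .nil
          simpa using ht.append_left this
        · rw [FreeGroup.mul_mk, List.singleton_append]
          exact (Quot.sound (FreeGroup.Red.Step.cons_not (b := true))).symm

/-- The computation is rebuilt from its end: a letter read joins the first derived piece, and a
stack operation is prepended with cancellation. -/
lemma exists_cutRun_of_run {p q : (pushdown f).Q} {w : List T} {x : G}
    (h : (pushdown f).Run p w x q) :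
    ∃ l, CutRun g p.1 w l q.1 ∧ FreeGroup.IsReduced l ∧ f (FreeGroup.mk l) = x := by
  induction h with
  | nil p => exact ⟨[], by simpa using CutRun.nil (g := g) (q := p.1) .nil,
      FreeGroup.IsReduced.nil, by simp [← FreeGroup.one_eq_mk]⟩
  | @eps p p' q x y w hs _ ih =>
    obtain ⟨l, hl, hred, rfl⟩ := ih
    have key (z : g.suffixForms × Bool) (hz : StackMove p.1 z p'.1)
        (hx : x = f (FreeGroup.mk [z])) :
        ∃ l', CutRun g p.1 w l' q.1 ∧ FreeGroup.IsReduced l' ∧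
          f (FreeGroup.mk l') = x * f (FreeGroup.mk l) := by
      obtain ⟨l', h₁, h₂, h₃⟩ := hl.exists_stackMove hz hred
      exact ⟨l', h₁, h₂, by rw [h₃, map_mul, hx]⟩
    rcases (mem_pushdown_step f).1 hs with ⟨a, ha, -⟩ | ⟨-, r, hr, s, hp, ho, hx⟩ | ⟨-, hp, hx⟩
    · simp at ha
    · exact key (s, true) ⟨r, hr, hp, ho⟩ hx
    · exact key (p', false) ⟨hp, rfl⟩ hx
  | @read p p' q x y w a hs _ ih =>
    obtain ⟨l, hl, hred, rfl⟩ := ih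
    rcases (mem_pushdown_step f).1 hs with ⟨b, hb, hp, hx⟩ | ⟨h, -⟩ | ⟨h, -⟩
    · obtain rfl : a = b := by simpa using hb
      obtain rfl : x = 1 := hx
      refine ⟨l, ?_, hred, by simp⟩
      rw [hp]
      exact hl.append_left (.terminal a .nil)
    · simp at h
    · simp at h

lemma language_pushdown (hf : Function.Injective f) : (pushdown f).language = g.language := by
  ext w
  rw [GroupAutomaton.mem_language_iff_run, mem_language_iff_yields]
  constructor
  · rintro ⟨q, rfl, h⟩
    obtain ⟨l, hl, hred, h1⟩ := exists_cutRun_of_run f h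
    have hl1 : FreeGroup.mk l = 1 := hf (by rw [h1, map_one])
    -- A reduced word representing 1 is empty, so no stack operation survives and what is left is a
    -- derivation.
    obtain rfl : l = [] := by
      classical
      have := congrArg FreeGroup.toWord hl1
      rwa [FreeGroup.toWord_mk, FreeGroup.toWord_one, hred.reduce_eq] at this
    generalize hp : (pushdown f).start.1 = p at hl
    cases hl with
    | nil h =>
      rw [List.append_nil] at hp
      rw [← hp] at h
      exact h
  · exact fun h => ⟨_, rfl, h.pushdown_run f _ _ rfl⟩

end ContextFreeGrammar

theorem contextFreeClass_subset_languageClass_SLTwoInt :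
    contextFreeClass ⊆ languageClass SLTwoInt := by
  rintro L ⟨g, hg⟩
  have : Finite g.suffixForms := g.finite_suffixForms
  obtain ⟨e, he⟩ := Countable.exists_injective_nat g.suffixForms
  exact ⟨ContextFreeGrammar.pushdown (freeRep.comp (FreeGroup.map e)), by
    rw [← hg]
    exact ContextFreeGrammar.language_pushdown _
      (freeRep_injective.comp (FreeGroup.map_injective he))⟩

/-! ### `SL(2,ℤ)` as an amalgamated product -/

/-- An element `R` of `SL(2,ℤ)` with `R³ = -1`. -/
def orderSix : SLTwoInt := ⟨!![1, -1; 1, 0], by simp⟩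

/-- The central elements `±1`. -/
def centralPart : Finset SLTwoInt := {1, -1}

/-- The noncentral elements of the two finite subgroups of `SL(2,ℤ)` whose amalgamated product it
is: `±S`, and `±R`, `±R²` where `R` is `orderSix`. -/
def factorPart : Bool → Finset SLTwoInt
  | false => {ModularGroup.S, -ModularGroup.S}
  | true => {orderSix, -orderSix, orderSix ^ 2, -orderSix ^ 2}

/-- The union of the two finite subgroups generated by `S` and by `orderSix`. -/
def factorUnion : Finset SLTwoInt := centralPart ∪ (factorPart false ∪ factorPart true)

lemma centralPart_mul {x y : SLTwoInt} (hx : x ∈ centralPart) (hy : y ∈ centralPart) :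
    x * y ∈ centralPart := by
  have : ∀ x ∈ centralPart, ∀ y ∈ centralPart, x * y ∈ centralPart := by decide
  exact this x hx y hy

lemma centralPart_mul_factorPart {b : Bool} {x y : SLTwoInt} (hx : x ∈ centralPart)
    (hy : y ∈ factorPart b) : x * y ∈ factorPart b := by
  have : ∀ b, ∀ x ∈ centralPart, ∀ y ∈ factorPart b, x * y ∈ factorPart b := by decide
  exact this b x hx y hy

lemma factorPart_mul {b : Bool} {x y : SLTwoInt} (hx : x ∈ factorPart b) (hy : y ∈ factorPart b) :
    x * y ∈ centralPart ∨ x * y ∈ factorPart b := by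
  have : ∀ b, ∀ x ∈ factorPart b, ∀ y ∈ factorPart b,
      x * y ∈ centralPart ∨ x * y ∈ factorPart b := by decide
  exact this b x hx y hy

lemma inv_mem_centralPart {x : SLTwoInt} (hx : x ∈ centralPart) : x⁻¹ ∈ centralPart := by
  revert x; decide

lemma disjoint_centralPart_factorPart {b : Bool} : Disjoint centralPart (factorPart b) := by
  revert b; decide

lemma inv_mem_factorUnion {x : SLTwoInt} (hx : x ∈ factorUnion) : x⁻¹ ∈ factorUnion := by
  revert x; decide

lemma mem_factorUnion {x : SLTwoInt} :
    x ∈ factorUnion ↔ x ∈ centralPart ∨ ∃ b, x ∈ factorPart b := by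
  simp [factorUnion]

lemma centralPart_subset_factorUnion {x : SLTwoInt} (hx : x ∈ centralPart) : x ∈ factorUnion :=
  mem_factorUnion.2 (.inl hx)

lemma factorPart_subset_factorUnion {b : Bool} {x : SLTwoInt} (hx : x ∈ factorPart b) :
    x ∈ factorUnion :=
  mem_factorUnion.2 (.inr ⟨b, hx⟩)

/-- The generators are `S` and `T = -R * S`; since the two finite subgroups are closed under
inverses, products without inverses suffice. -/
lemma exists_factorization (x : SLTwoInt) :
    ∃ l : List SLTwoInt, (∀ y ∈ l, y ∈ factorUnion) ∧ l.prod = x := by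
  have h : Subgroup.closure (factorUnion : Set SLTwoInt) = ⊤ := by
    rw [eq_top_iff, ← SpecialLinearGroup.SL2Z_generators, Subgroup.closure_le]
    have hS : ModularGroup.S ∈ Subgroup.closure (factorUnion : Set SLTwoInt) :=
      Subgroup.subset_closure (Finset.mem_coe.2 (by decide))
    have hR : -orderSix ∈ Subgroup.closure (factorUnion : Set SLTwoInt) :=
      Subgroup.subset_closure (Finset.mem_coe.2 (by decide))
    rintro _ (rfl | rfl)
    · exact hS
    · have hT : ModularGroup.T = -orderSix * ModularGroup.S := by decide
      rw [hT]
      exact mul_mem hR hS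
  have hx : x ∈ (Subgroup.closure (factorUnion : Set SLTwoInt)).toSubmonoid :=
    h ▸ Subgroup.mem_top x
  rw [Subgroup.closure_toSubmonoid] at hx
  obtain ⟨l, hl, hx⟩ := Submonoid.exists_list_of_mem_closure hx
  exact ⟨l, fun y hy => (hl y hy).elim id fun h => inv_inv y ▸ inv_mem_factorUnion h, hx⟩

/-- `Alternating b l`: the entries of `l` come alternately from the two factors, the first one
from `factorPart b`. -/
inductive Alternating : Bool → List SLTwoInt → Prop
  | nil (b : Bool) : Alternating b []
  | cons {b : Bool} {x : SLTwoInt} {l : List SLTwoInt} (hx : x ∈ factorPart b)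
      (hl : Alternating (!b) l) : Alternating b (x :: l)

/-- These elements send `(p, q)` to `±(p - q, p)` or `±(-q, p - q)`; if `p` and `q` have opposite
signs, both coordinates of the image share a sign and differ. -/
lemma factorPart_true_mulVec {x : SLTwoInt} (hx : x ∈ factorPart true) {v : Fin 2 → ℤ}
    (hv : v 0 * v 1 < 0) :
    0 < x.1.mulVec v 0 * x.1.mulVec v 1 ∧ x.1.mulVec v 0 ≠ x.1.mulVec v 1 := by
  have h0 : v 0 ≠ 0 := fun h => by simp [h] at hv
  have h1 : v 1 ≠ 0 := fun h => by simp [h] at hv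
  have hcases : ∀ x ∈ factorPart true, x.1 = !![1, -1; 1, 0] ∨ x.1 = !![-1, 1; -1, 0] ∨
      x.1 = !![0, -1; 1, -1] ∨ x.1 = !![0, 1; -1, 1] := by decide
  have hsq0 := sq_nonneg (v 0)
  have hsq1 := sq_nonneg (v 1)
  rcases hcases x hx with h | h | h | h <;> rw [h] <;>
    simp only [Matrix.mulVec, dotProduct, Fin.sum_univ_two, Matrix.of_apply, Matrix.cons_val_zero,
      Matrix.cons_val_one] <;>
    exact ⟨by nlinarith, by omega⟩

lemma factorPart_false_mulVec {x : SLTwoInt} (hx : x ∈ factorPart false) (v : Fin 2 → ℤ) :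
    x.1.mulVec v 0 * x.1.mulVec v 1 = - (v 0 * v 1) ∧
      (x.1.mulVec v 0 = - x.1.mulVec v 1 ↔ v 0 = v 1) := by
  have hcases : ∀ x ∈ factorPart false, x.1 = !![0, -1; 1, 0] ∨ x.1 = !![0, 1; -1, 0] := by decide
  rcases hcases x hx with h | h <;> rw [h] <;>
    simp only [Matrix.mulVec, dotProduct, Fin.sum_univ_two, Matrix.of_apply, Matrix.cons_val_zero,
      Matrix.cons_val_one] <;>
    exact ⟨by ring, by omega⟩

/-- Ping-pong for the two factors, played with the signs of the coordinates. -/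
lemma Alternating.exists_mulVec {b : Bool} {x : SLTwoInt} {l : List SLTwoInt}
    (h : Alternating b (x :: l)) :
    ∃ v : Fin 2 → ℤ, |v 0| = |v 1| ∧
      (b = true → 0 < (x :: l).prod.1.mulVec v 0 * (x :: l).prod.1.mulVec v 1 ∧
        (x :: l).prod.1.mulVec v 0 ≠ (x :: l).prod.1.mulVec v 1) ∧
      (b = false → (x :: l).prod.1.mulVec v 0 * (x :: l).prod.1.mulVec v 1 < 0 ∧
        ((x :: l).prod.1.mulVec v 0 ≠ - (x :: l).prod.1.mulVec v 1 ∨ l = [])) := by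
  induction l generalizing b x with
  | nil =>
    cases h with
    | cons hx _ =>
      rw [List.prod_singleton]
      cases b
      -- The starting vector depends on the type of the last letter. A lone `±S` sends the diagonal
      -- to the antidiagonal, hence the exception `l = []`.
      · refine ⟨![1, 1], by simp, by simp, fun _ => ⟨?_, .inr rfl⟩⟩
        rw [(factorPart_false_mulVec hx _).1]
        simp
      · exact ⟨![1, -1], by simp, fun _ => factorPart_true_mulVec hx (by simp), by simp⟩
  | cons y l ih =>
    cases h with
    | cons hx hl =>
      obtain ⟨v, hv, ht, hf⟩ := ih hl
      refine ⟨v, hv, ?_⟩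
      rw [List.prod_cons, Matrix.SpecialLinearGroup.coe_mul, ← Matrix.mulVec_mulVec]
      cases b
      · obtain ⟨h₁, h₂⟩ := ht rfl
        obtain ⟨h₃, h₄⟩ := factorPart_false_mulVec hx ((y :: l).prod.1.mulVec v)
        exact ⟨by simp, fun _ => ⟨by rw [h₃]; exact neg_neg_of_pos h₁, .inl (mt h₄.1 h₂)⟩⟩
      · exact ⟨fun _ => factorPart_true_mulVec hx (hf rfl).1, by simp⟩

/-- The matrices `±1` preserve `|v 0| = |v 1|`, while the ping-pong moves `v` off both diagonals.
The one exception, a single letter `±S`, is visibly not central. -/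
lemma Alternating.prod_notMem_centralPart {b : Bool} {x : SLTwoInt} {l : List SLTwoInt}
    (h : Alternating b (x :: l)) : (x :: l).prod ∉ centralPart := by
  intro hc
  obtain ⟨v, hv, ht, hf⟩ := h.exists_mulVec
  have habs : |(x :: l).prod.1.mulVec v 0| = |(x :: l).prod.1.mulVec v 1| := by
    rcases (by simpa [centralPart] using hc : (x :: l).prod = 1 ∨ (x :: l).prod = -1) with h | h <;>
      rw [h] <;> simpa [Matrix.neg_mulVec] using hv
  rw [abs_eq_abs] at habs
  cases b
  · obtain ⟨h₁, h₂ | rfl⟩ := hf rfl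
    · rcases habs with habs | habs
      · rw [habs] at h₁
        exact absurd h₁ (not_lt.2 (mul_self_nonneg _))
      · exact h₂ habs
    · cases h with
      | cons hx _ =>
        rw [List.prod_singleton] at hc
        exact Finset.disjoint_left.1 disjoint_centralPart_factorPart hc hx
  · obtain ⟨h₁, h₂⟩ := ht rfl
    rcases habs with habs | habs
    · exact h₂ habs
    · rw [habs, neg_mul] at h₁
      linarith [mul_self_nonneg ((x :: l).prod.1.mulVec v 1)]

/-- A factorization of `x` over `factorUnion`. -/
noncomputable def factorWord (x : SLTwoInt) : List SLTwoInt := (exists_factorization x).choose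

lemma mem_factorUnion_of_mem_factorWord {x y : SLTwoInt} (h : y ∈ factorWord x) :
    y ∈ factorUnion := (exists_factorization x).choose_spec.1 y h

lemma prod_factorWord (x : SLTwoInt) : (factorWord x).prod = x :=
  (exists_factorization x).choose_spec.2

/-! ### Languages recognized over `SL(2,ℤ)` are context-free -/

namespace GroupAutomaton

variable {A : Type} (E : GroupAutomaton A SLTwoInt)

/-- The states of the automaton that multiplies the register by one element of `factorUnion` at
a time: a state of `E`, and the factors still to be processed. -/
def points : Set (E.Q × List SLTwoInt) :=
  {p | p.2 = [] ∨ ∃ q σ, ∃ x ∈ E.step q σ, p.2 <:+ factorWord x.2}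

lemma finite_points [Finite A] : E.points.Finite := by
  have := E.finite_Q
  have hfin (t : List SLTwoInt) : {s | s <:+ t}.Finite :=
    (List.finite_toSet t.tails).subset fun s hs => by simpa using hs
  have hU : (⋃ q, ⋃ σ, ⋃ x ∈ E.step q σ, {s | s <:+ factorWord x.2}).Finite :=
    Set.finite_iUnion fun q => Set.finite_iUnion fun σ =>
      (E.step q σ).finite_toSet.biUnion fun x _ => hfin _
  refine (Set.finite_univ.prod ((Set.finite_singleton []).union hU)).subset ?_
  rintro p (hp | ⟨q, σ, x, hx, hp⟩)
  · exact ⟨trivial, .inl hp⟩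
  · refine ⟨trivial, .inr ?_⟩
    simp only [Set.mem_iUnion]
    exact ⟨q, σ, x, hx, hp⟩

variable {E}

lemma mem_points_of_suffix {q q' : E.Q} {u v : List SLTwoInt} (h : (q, v) ∈ E.points)
    (huv : u <:+ v) : (q', u) ∈ E.points := by
  rcases h with h | ⟨q, σ, x, hx, h⟩
  · exact .inl (List.suffix_nil.1 (h ▸ huv))
  · exact .inr ⟨q, σ, x, hx, huv.trans h⟩

lemma mem_points_factorWord {q q' : E.Q} {σ : Option A} {g : SLTwoInt}
    (h : (q', g) ∈ E.step q σ) : (q', factorWord g) ∈ E.points :=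
  .inr ⟨q, σ, _, h, List.suffix_rfl⟩

variable (E)

/-- The nonterminals of `triangleGrammar`: `some (p, d, q)` stands for the words read by the
computations from `p` to `q` that multiply the register by `d`. -/
abbrev Triple : Type := Option ((E.Q × List SLTwoInt) × SLTwoInt × (E.Q × List SLTwoInt))

/-- The rules of `triangleGrammar`. -/
def triangleRules : Set (ContextFreeRule A E.Triple) :=
  {r | (∃ p ∈ E.points, r = ⟨some (p, 1, p), []⟩) ∨
    (∃ p ∈ E.points, ∃ q ∈ E.points, ∃ t ∈ E.points, ∃ c ∈ factorUnion, ∃ d ∈ factorUnion,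
      r = ⟨some (p, c * d, t), [.nonterminal (some (p, c, q)), .nonterminal (some (q, d, t))]⟩) ∨
    (∃ p ∈ E.points, ∃ d u, p.2 = d :: u ∧ r = ⟨some (p, d, (p.1, u)), []⟩) ∨
    (∃ q σ, ∃ x ∈ E.step q σ,
      r = ⟨some ((q, []), 1, (x.1, factorWord x.2)), σ.toList.map .terminal⟩) ∨
    ∃ q ∈ E.accept, r = ⟨none, [.nonterminal (some ((E.start, []), 1, (q, [])))]⟩}

lemma finite_triangleRules [Finite A] : E.triangleRules.Finite := by
  have := E.finite_Q
  have hP := E.finite_points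
  have hD := factorUnion.finite_toSet
  refine .union ?_ (.union ?_ (.union ?_ (.union ?_ ?_)))
  · exact (hP.image fun p => ⟨some (p, 1, p), []⟩).subset fun r ⟨p, hp, hr⟩ => ⟨p, hp, hr.symm⟩
  · refine ((hP.prod (hP.prod (hP.prod (hD.prod hD)))).image fun y =>
      ⟨some (y.1, y.2.2.2.1 * y.2.2.2.2, y.2.2.1),
        [.nonterminal (some (y.1, y.2.2.2.1, y.2.1)),
          .nonterminal (some (y.2.1, y.2.2.2.2, y.2.2.1))]⟩).subset ?_
    rintro r ⟨p, hp, q, hq, t, ht, c, hc, d, hd, hr⟩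
    exact ⟨(p, q, t, c, d), ⟨hp, hq, ht, hc, hd⟩, hr.symm⟩
  -- For an empty list the default head only adds a superfluous rule to the finite superset.
  · refine (hP.image fun p => ⟨some (p, p.2.headI, (p.1, p.2.tail)), []⟩).subset ?_
    rintro r ⟨p, hp, d, u, hu, hr⟩
    exact ⟨p, hp, by simp [hr, hu]⟩
  · have : (⋃ q, ⋃ σ : Option A, (fun x : E.Q × SLTwoInt => (⟨some ((q, []), 1,
        (x.1, factorWord x.2)), σ.toList.map .terminal⟩ : ContextFreeRule A E.Triple)) ''
          (E.step q σ : Set (E.Q × SLTwoInt))).Finite :=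
      Set.finite_iUnion fun q => Set.finite_iUnion fun σ => (E.step q σ).finite_toSet.image _
    refine this.subset ?_
    rintro r ⟨q, σ, x, hx, hr⟩
    simp only [Set.mem_iUnion]
    exact ⟨q, σ, x, hx, hr.symm⟩
  · exact ((Set.toFinite E.accept).image fun q =>
      ⟨none, [.nonterminal (some ((E.start, []), 1, (q, [])))]⟩).subset
        fun r ⟨q, hq, hr⟩ => ⟨q, hq, hr.symm⟩

/-- The grammar that cuts computations of `E` into two, as long as both parts multiply the register
by an element of `factorUnion`. -/
noncomputable def triangleGrammar [Finite A] : ContextFreeGrammar A where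
  NT := E.Triple
  initial := none
  rules := E.finite_triangleRules.toFinset

/-- The meaning of the nonterminals of `triangleGrammar`. -/
def tripleSem : E.Triple → List A → Prop
  | none, w => w ∈ E.language
  | some (p, d, q), w => ∃ g, E.Run p.1 w g q.1 ∧ p.2.prod * g = d * q.2.prod

variable {E} [Finite A]

lemma mem_triangleGrammar_rules {r : ContextFreeRule A E.Triple} :
    r ∈ E.triangleGrammar.rules ↔ r ∈ E.triangleRules :=
  Set.Finite.mem_toFinset _

/-- Soundness: `d` accounts for the register change once the factors pending at either end are
counted. It does not depend on `d` lying in `factorUnion`, which serves the finiteness of the rules.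
-/
lemma tripleSem_of_mem_rules (r : ContextFreeRule A E.Triple) (hr : r ∈ E.triangleGrammar.rules)
    (w : List A) (hw : ContextFreeGrammar.Denotes E.tripleSem r.output w) :
    E.tripleSem r.input w := by
  rcases mem_triangleGrammar_rules.1 hr with ⟨p, -, rfl⟩ |
    ⟨p, -, q, -, t, -, c, -, d, -, rfl⟩ | ⟨p, -, d, u, hu, rfl⟩ | ⟨q, σ, x, hx, rfl⟩ | ⟨q, hq, rfl⟩
  · obtain rfl : w = [] := hw
    exact ⟨1, .nil _, by simp⟩
  · obtain ⟨u, v, rfl, ⟨g, hg, hpg⟩, _, _, rfl, ⟨h, hh, hqh⟩, rfl⟩ := hw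
    refine ⟨g * h, ?_, ?_⟩
    · simpa using hg.trans hh
    · rw [← mul_assoc, hpg, mul_assoc, hqh, mul_assoc]
  · obtain rfl : w = [] := hw
    exact ⟨1, .nil _, by simp [hu]⟩
  · have hw' : w = σ.toList := by
      cases σ with
      | none => exact hw
      | some a =>
        obtain ⟨v, rfl, rfl⟩ := hw
        rfl
    rw [hw']
    exact ⟨x.2, .of_mem_step hx, by simp [prod_factorWord]⟩
  · obtain ⟨u, _, rfl, ⟨g, hg, hg1⟩, rfl⟩ := hw
    obtain rfl : g = 1 := by simpa using hg1
    rw [List.append_nil]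
    exact mem_language_iff_run.2 ⟨q, hq, hg⟩

variable (E) in
/-- `w` is derived from the nonterminal `(p, d, q)`. -/
def Cut (p : E.Q × List SLTwoInt) (w : List A) (d : SLTwoInt) (q : E.Q × List SLTwoInt) : Prop :=
  p ∈ E.points ∧ q ∈ E.points ∧ E.triangleGrammar.Yields [.nonterminal (some (p, d, q))] w

lemma yields_of_mem_triangleRules {N : E.Triple} {s : List (Symbol A E.Triple)} {w : List A}
    (hr : ⟨N, s⟩ ∈ E.triangleRules) (h : E.triangleGrammar.Yields s w) :
    E.triangleGrammar.Yields [.nonterminal N] w := by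
  simpa using ContextFreeGrammar.Yields.nonterminal (mem_triangleGrammar_rules.2 hr) h .nil

lemma Cut.refl {p : E.Q × List SLTwoInt} (hp : p ∈ E.points) : E.Cut p [] 1 p :=
  ⟨hp, hp, yields_of_mem_triangleRules (.inl ⟨p, hp, rfl⟩) .nil⟩

lemma Cut.mul {p q t : E.Q × List SLTwoInt} {u v : List A} {c d : SLTwoInt} (h₁ : E.Cut p u c q)
    (h₂ : E.Cut q v d t) (hc : c ∈ factorUnion) (hd : d ∈ factorUnion) :
    E.Cut p (u ++ v) (c * d) t :=
  ⟨h₁.1, h₂.2.1, yields_of_mem_triangleRules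
    (.inr (.inl ⟨p, h₁.1, q, h₁.2.1, t, h₂.2.1, c, hc, d, hd, rfl⟩)) (h₁.2.2.append h₂.2.2)⟩

lemma Cut.factor {q : E.Q} {d : SLTwoInt} {u : List SLTwoInt} (h : (q, d :: u) ∈ E.points) :
    E.Cut (q, d :: u) [] d (q, u) :=
  ⟨h, mem_points_of_suffix h (List.suffix_cons _ _),
    yields_of_mem_triangleRules (.inr (.inr (.inl ⟨_, h, d, u, rfl, rfl⟩))) .nil⟩

lemma Cut.step {q q' : E.Q} {σ : Option A} {g : SLTwoInt} (h : (q', g) ∈ E.step q σ) :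
    E.Cut (q, []) σ.toList 1 (q', factorWord g) :=
  ⟨.inl rfl, mem_points_factorWord h, yields_of_mem_triangleRules
    (.inr (.inr (.inr (.inl ⟨q, σ, _, h, rfl⟩)))) (ContextFreeGrammar.yields_map_terminal _)⟩

variable (E) in
/-- A computation cut into pieces that multiply the register by the entries of the list in the
third argument, and a last piece that multiplies it by the central element in the fourth. -/
inductive CutRun : E.Q × List SLTwoInt → List A → List SLTwoInt → SLTwoInt →
    E.Q × List SLTwoInt → Prop
  | nil {p q : E.Q × List SLTwoInt} {w : List A} {c : SLTwoInt} (hc : c ∈ centralPart)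
      (h : E.Cut p w c q) : CutRun p w [] c q
  | cons {p p' q : E.Q × List SLTwoInt} {v w : List A} {l : List SLTwoInt} {x c : SLTwoInt}
      (h : E.Cut p v x p') (ht : CutRun p' w l c q) : CutRun p (v ++ w) (x :: l) c q

variable (E) in
/-- Some cutting of a computation from `p` to `q` that reads `w` and multiplies the register by `g`
is alternating. -/
def HasNormalForm (p : E.Q × List SLTwoInt) (w : List A) (g : SLTwoInt)
    (q : E.Q × List SLTwoInt) : Prop :=
  ∃ b l c, E.CutRun p w l c q ∧ Alternating b l ∧ l.prod * c = g

/-- A central piece is absorbed by the next one without changing its factor, so alternation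
survives. -/
lemma CutRun.hasNormalForm_central {p p' q : E.Q × List SLTwoInt} {v w : List A}
    {x c : SLTwoInt} {l : List SLTwoInt} {b : Bool} (hx : x ∈ centralPart) (h : E.Cut p v x p')
    (hr : E.CutRun p' w l c q) (hl : Alternating b l) :
    E.HasNormalForm p (v ++ w) (x * (l.prod * c)) q := by
  cases hr with
  | nil hc hcut =>
    exact ⟨b, [], x * c, .nil (centralPart_mul hx hc) (h.mul hcut
      (centralPart_subset_factorUnion hx) (centralPart_subset_factorUnion hc)), .nil b, by simp⟩
  | @cons _ _ _ _ _ l y _ hcut ht =>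
    cases hl with
    | cons hy hl =>
      refine ⟨b, x * y :: l, c, ?_, .cons (centralPart_mul_factorPart hx hy) hl,
        by simp [mul_assoc]⟩
      rw [← List.append_assoc]
      exact .cons (h.mul hcut (centralPart_subset_factorUnion hx)
        (factorPart_subset_factorUnion hy)) ht

/-- Two neighbouring pieces from the same factor merge into one piece of that finite group. If it is
noncentral it replaces both; if it is central it is absorbed further. Each merge is an application
of the binary rule, whose two elements lie in `factorUnion`. -/
lemma HasNormalForm.cut_mul {p p' q : E.Q × List SLTwoInt} {v w : List A} {x g : SLTwoInt}
    (hx : x ∈ factorUnion) (h : E.Cut p v x p') (hn : E.HasNormalForm p' w g q) :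
    E.HasNormalForm p (v ++ w) (x * g) q := by
  obtain ⟨b, l, c, hr, hl, rfl⟩ := hn
  rcases mem_factorUnion.1 hx with hx' | ⟨b', hx'⟩
  · exact hr.hasNormalForm_central hx' h hl
  have hkeep (hl' : Alternating (!b') l) : E.HasNormalForm p (v ++ w) (x * (l.prod * c)) q :=
    ⟨b', x :: l, c, .cons h hr, .cons hx' hl', by simp [mul_assoc]⟩
  by_cases hb : b = !b'
  · exact hkeep (hb ▸ hl)
  obtain rfl : b = b' := by simpa using hb
  cases hl with
  | nil => exact hkeep (.nil _)
  | @cons _ y l hy hl =>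
    cases hr with
    | cons hcut ht =>
      have hcut' := h.mul hcut hx (factorPart_subset_factorUnion hy)
      rw [← List.append_assoc]
      rcases factorPart_mul hx' hy with hxy | hxy
      · simpa [mul_assoc] using ht.hasNormalForm_central hxy hcut' hl
      · exact ⟨b, x * y :: l, c, .cons hcut' ht, .cons hxy hl, by simp [mul_assoc]⟩

lemma HasNormalForm.factors_mul {q : E.Q} {t : E.Q × List SLTwoInt} {w : List A} {g : SLTwoInt}
    (hn : E.HasNormalForm (q, []) w g t) {u : List SLTwoInt} (hu : (q, u) ∈ E.points)
    (hmem : ∀ y ∈ u, y ∈ factorUnion) : E.HasNormalForm (q, u) w (u.prod * g) t := by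
  induction u with
  | nil => simpa using hn
  | cons d u ih =>
    have := (ih (mem_points_of_suffix hu (List.suffix_cons _ _))
      fun y hy => hmem y (List.mem_cons_of_mem _ hy)).cut_mul (hmem d List.mem_cons_self)
        (Cut.factor hu)
    simpa [mul_assoc] using this

lemma HasNormalForm.step_mul {q q' : E.Q} {t : E.Q × List SLTwoInt} {σ : Option A} {w : List A}
    {g h : SLTwoInt} (hs : (q', g) ∈ E.step q σ) (hn : E.HasNormalForm (q', []) w h t) :
    E.HasNormalForm (q, []) (σ.toList ++ w) (g * h) t := by
  have h₁ := hn.factors_mul (mem_points_factorWord hs)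
    fun y hy => mem_factorUnion_of_mem_factorWord hy
  have h₂ := h₁.cut_mul (by decide) (Cut.step hs)
  rwa [prod_factorWord, one_mul] at h₂

lemma Run.hasNormalForm {q q' : E.Q} {w : List A} {g : SLTwoInt} (h : E.Run q w g q') :
    E.HasNormalForm (q, []) w g (q', []) := by
  induction h with
  | nil q => exact ⟨true, [], 1, .nil (by decide) (.refl (.inl rfl)), .nil _, by simp⟩
  | eps hs _ ih => exact ih.step_mul hs
  | read a hs _ ih => exact ih.step_mul hs

lemma CutRun.mem_centralPart {p q : E.Q × List SLTwoInt} {w : List A} {l : List SLTwoInt}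
    {c : SLTwoInt} (h : E.CutRun p w l c q) : c ∈ centralPart := by
  induction h with
  | nil hc _ => exact hc
  | cons _ _ ih => exact ih

/-- If the total product is 1, the alternating part equals the inverse of a central element, so it
is empty and a single piece remains. -/
lemma HasNormalForm.cut_one {p q : E.Q × List SLTwoInt} {w : List A}
    (h : E.HasNormalForm p w 1 q) : E.Cut p w 1 q := by
  obtain ⟨b, l, c, hr, hl, h1⟩ := h
  have hc := inv_mem_centralPart hr.mem_centralPart
  cases hr with
  | nil _ hcut =>
    obtain rfl : c = 1 := by simpa using h1
    exact hcut
  | cons =>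
    rw [← eq_inv_of_mul_eq_one_left h1] at hc
    exact absurd hc hl.prod_notMem_centralPart

variable (E) in
lemma language_triangleGrammar : E.triangleGrammar.language = E.language := by
  ext w
  rw [ContextFreeGrammar.mem_language_iff_yields]
  constructor
  · intro h
    obtain ⟨u, _, rfl, hu, rfl⟩ := h.denotes tripleSem_of_mem_rules
    rw [List.append_nil]
    exact hu
  · intro h
    obtain ⟨q, hq, hrun⟩ := mem_language_iff_run.1 h
    exact yields_of_mem_triangleRules (.inr (.inr (.inr (.inr ⟨q, hq, rfl⟩))))
      hrun.hasNormalForm.cut_one.2.2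

end GroupAutomaton

theorem languageClass_SLTwoInt_subset_contextFreeClass :
    languageClass SLTwoInt ⊆ contextFreeClass := by
  rintro L ⟨E, hE⟩
  have := L.finite_alphabet
  exact ⟨E.triangleGrammar, E.language_triangleGrammar.trans hE⟩

/-! ### Unary context-free languages are regular -/

namespace ContextFreeGrammar

variable {T : Type*} {g : ContextFreeGrammar T}

/-- `g.YieldsLength Z s n`: the sentential form `s` derives a word of length `n` by parse trees
whose nonterminals all lie in `Z`. -/
inductive YieldsLength (g : ContextFreeGrammar T) (Z : Set g.NT) :
    List (Symbol T g.NT) → ℕ → Prop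
  | nil : YieldsLength g Z [] 0
  | terminal (a : T) {s : List (Symbol T g.NT)} {n : ℕ} (h : YieldsLength g Z s n) :
      YieldsLength g Z (.terminal a :: s) (n + 1)
  | nonterminal {r : ContextFreeRule T g.NT} {s : List (Symbol T g.NT)} {m n : ℕ}
      (hr : r ∈ g.rules) (hZ : r.input ∈ Z) (h₁ : YieldsLength g Z r.output m)
      (h₂ : YieldsLength g Z s n) :
      YieldsLength g Z (.nonterminal r.input :: s) (m + n)

lemma YieldsLength.mono {Z Z' : Set g.NT} (hZ : Z ⊆ Z') {s : List (Symbol T g.NT)} {n : ℕ}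
    (h : g.YieldsLength Z s n) : g.YieldsLength Z' s n := by
  induction h with
  | nil => exact .nil
  | terminal a _ ih => exact .terminal a ih
  | nonterminal hr hA _ _ ih₁ ih₂ => exact .nonterminal hr (hZ hA) ih₁ ih₂

lemma yieldsLength_univ_iff {s : List (Symbol T g.NT)} {n : ℕ} :
    g.YieldsLength Set.univ s n ↔ ∃ w, g.Yields s w ∧ w.length = n := by
  constructor
  · intro h
    induction h with
    | nil => exact ⟨[], .nil, rfl⟩
    | terminal a _ ih =>
      obtain ⟨w, hw, rfl⟩ := ih
      exact ⟨a :: w, .terminal a hw, rfl⟩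
    | nonterminal hr _ _ _ ih₁ ih₂ =>
      obtain ⟨u, hu, rfl⟩ := ih₁
      obtain ⟨w, hw, rfl⟩ := ih₂
      exact ⟨u ++ w, .nonterminal hr hu hw, List.length_append⟩
  · rintro ⟨w, hw, rfl⟩
    induction hw with
    | nil => exact .nil
    | terminal a _ ih => exact .terminal a ih
    | nonterminal hr _ _ ih₁ ih₂ =>
      rw [List.length_append]
      exact .nonterminal hr trivial ih₁ ih₂

variable (g) in
/-- Replacing a tree with root `A` of any yield length `m` in a tree for `s` gives one of yield
length `k + m`. -/
def IsContextLength (s : List (Symbol T g.NT)) (A : g.NT) (k : ℕ) : Prop :=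
  ∀ m, g.YieldsLength Set.univ [.nonterminal A] m → g.YieldsLength Set.univ s (k + m)

lemma YieldsLength.nonterminal_singleton {Z : Set g.NT} {r : ContextFreeRule T g.NT} {m : ℕ}
    (hr : r ∈ g.rules) (hZ : r.input ∈ Z) (h : g.YieldsLength Z r.output m) :
    g.YieldsLength Z [.nonterminal r.input] m := by
  simpa using YieldsLength.nonterminal hr hZ h .nil

lemma YieldsLength.append_singleton {Z : Set g.NT} {A : g.NT} {s : List (Symbol T g.NT)} {m n : ℕ}
    (h₁ : g.YieldsLength Z [.nonterminal A] m) (h₂ : g.YieldsLength Z s n) :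
    g.YieldsLength Z (.nonterminal A :: s) (m + n) := by
  cases h₁ with
  | nonterminal hr hZ h₁ h₀ =>
    cases h₀
    simpa using YieldsLength.nonterminal hr hZ h₁ h₂

/-- A forest either avoids the nonterminals in `W`, or contains a subtree with root in `W` and no
further nonterminals from `W`. -/
lemma YieldsLength.diff_or_exists {Z : Set g.NT} (W : Set g.NT) {s : List (Symbol T g.NT)} {n : ℕ}
    (h : g.YieldsLength Z s n) :
    g.YieldsLength (Z \ W) s n ∨
      ∃ r ∈ g.rules, r.input ∈ W ∧ ∃ k m, n = k + m ∧ g.YieldsLength (Z \ W) r.output m ∧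
        g.IsContextLength s r.input k := by
  induction h with
  | nil => exact .inl .nil
  | terminal a _ ih =>
    rcases ih with ih | ⟨r, hr, hW, k, m, rfl, hm, hk⟩
    · exact .inl (.terminal a ih)
    · refine .inr ⟨r, hr, hW, k + 1, m, by omega, hm, fun m' hm' => ?_⟩
      rw [add_right_comm]
      exact .terminal a (hk m' hm')
  | @nonterminal r s i j hr hZ h₁ h₂ ih₁ ih₂ =>
    have h₁' := h₁.mono (Set.subset_univ _)
    have h₂' := h₂.mono (Set.subset_univ _)
    rcases ih₁ with ih₁ | ⟨r', hr', hW, k, m, rfl, hm, hk⟩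
    · by_cases hW : r.input ∈ W
      · refine .inr ⟨r, hr, hW, j, i, add_comm _ _, ih₁, fun m' hm' => ?_⟩
        rw [add_comm]
        exact hm'.append_singleton h₂'
      rcases ih₂ with ih₂ | ⟨r', hr', hW', k, m, rfl, hm, hk⟩
      · exact .inl (.nonterminal hr ⟨hZ, hW⟩ ih₁ ih₂)
      · refine .inr ⟨r', hr', hW', i + k, m, by omega, hm, fun m' hm' => ?_⟩
        rw [add_assoc]
        exact .nonterminal hr trivial h₁' (hk m' hm')
    · refine .inr ⟨r', hr', hW, k + j, m, by omega, hm, fun m' hm' => ?_⟩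
      rw [add_right_comm]
      exact .nonterminal hr trivial (hk m' hm') h₂'

variable (g) in
/-- `A` has no context of positive length that yields `A` from itself. -/
def IsAperiodic (A : g.NT) : Prop := ∀ k, g.IsContextLength [.nonterminal A] A k → k = 0

-- Induction on the number of allowed nonterminals. In a tree with root `A`, a subtree with root `A`
-- and no further `A` below has the same yield length, because aperiodicity makes its context empty;
-- below that root one nonterminal fewer is available.
variable (g) in
lemma exists_bound_of_isAperiodic (N : ℕ) :
    ∃ B, ∀ Z : Finset g.NT, Z.card = N → (∀ A ∈ Z, g.IsAperiodic A) →
      ∀ s n, g.YieldsLength Z s n → n ≤ B * s.length := by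
  classical
  induction N with
  | zero =>
    refine ⟨1, fun Z hZ _ s n h => ?_⟩
    obtain rfl := Finset.card_eq_zero.1 hZ
    induction h with
    | nil => simp
    | terminal a _ ih => simpa using ih
    | nonterminal _ hA => simp at hA
  | succ N ih =>
    obtain ⟨B, hB⟩ := ih
    obtain ⟨C, hC⟩ : ∃ C, ∀ r ∈ g.rules, r.output.length ≤ C :=
      ⟨g.rules.sup fun r => r.output.length,
        fun r hr => Finset.le_sup (f := fun r => r.output.length) hr⟩
    -- A nonterminal of the form contributes at most `B * C`, a terminal exactly 1.
    refine ⟨B * C + 1, fun Z hZ hap s n h => ?_⟩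
    have hroot (A : g.NT) (hA : A ∈ Z) (m : ℕ) (hm : g.YieldsLength Z [.nonterminal A] m) :
        m ≤ B * C := by
      have hsub : (Z : Set g.NT) \ {A} = (Z.erase A : Finset g.NT) := by simp
      rcases hm.diff_or_exists {A} with h | ⟨r, hr, rfl, k, m, rfl, hm', hk⟩
      · cases h with
        | nonterminal _ hZ' => exact absurd rfl hZ'.2
      · rw [hap _ hA k hk, zero_add]
        rw [hsub] at hm'
        refine (hB _ (by rw [Finset.card_erase_of_mem hA, hZ]; rfl)
          (fun A' h' => hap _ (Finset.mem_of_mem_erase h')) _ _ hm').trans ?_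
        exact Nat.mul_le_mul_left _ (hC r hr)
    induction h with
    | nil => simp
    | terminal a _ ih => rw [List.length_cons]; nlinarith
    | nonterminal hr hA h₁ _ _ ih₂ =>
      have := hroot _ hA _ (.nonterminal_singleton hr hA h₁)
      rw [List.length_cons]
      nlinarith

lemma IsContextLength.mul {A : g.NT} {k : ℕ} (h : g.IsContextLength [.nonterminal A] A k) (i : ℕ) :
    g.IsContextLength [.nonterminal A] A (k * i) := by
  induction i with
  | zero => intro m hm; simpa using hm
  | succ i ih =>
    intro m hm
    have := h _ (ih m hm)
    rwa [← add_assoc, ← mul_one_add, add_comm 1] at this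

variable (g) in
/-- The lengths of the words of a context-free language are, from some point on, closed under
addition of some positive period. -/
theorem exists_period :
    ∃ P > 0, ∃ B, ∀ n > B, (∃ w ∈ g.language, w.length = n) →
      ∃ w ∈ g.language, w.length = n + P := by
  classical
  let inputs := g.rules.image ContextFreeRule.input
  let Z := inputs.filter g.IsAperiodic
  obtain ⟨B, hB⟩ := g.exists_bound_of_isAperiodic Z.card
  have hper (A : g.NT) : ∃ k > 0, ¬ g.IsAperiodic A → g.IsContextLength [.nonterminal A] A k := by
    by_cases hA : g.IsAperiodic A
    · exact ⟨1, one_pos, fun h => absurd hA h⟩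
    · obtain ⟨k, hk, hk0⟩ : ∃ k, g.IsContextLength [.nonterminal A] A k ∧ k ≠ 0 := by
        simpa [IsAperiodic] using hA
      exact ⟨k, Nat.pos_of_ne_zero hk0, fun _ => hk⟩
  choose per hpos hper using hper
  -- The product is a common multiple of all periods; aperiodic nonterminals got the dummy value 1.
  refine ⟨∏ A ∈ inputs, per A, Finset.prod_pos fun A _ => hpos A, B, fun n hn hw => ?_⟩
  simp only [mem_language_iff_yields, ← yieldsLength_univ_iff] at hw ⊢
  -- A tree with only aperiodic nonterminals has yield length at most `B`; otherwise some periodic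
  -- nonterminal can be pumped by the common period.
  rcases hw.diff_or_exists {A | ¬ g.IsAperiodic A} with h | ⟨r, hr, hW, k, m, rfl, hm, hk⟩
  · have hZ : g.YieldsLength (Z : Set g.NT) [.nonterminal g.initial] n := by
      clear hn hw
      generalize [Symbol.nonterminal g.initial] = s at h
      induction h with
      | nil => exact .nil
      | terminal a _ ih => exact .terminal a ih
      | @nonterminal r _ _ _ hr hA _ _ ih₁ ih₂ =>
        refine .nonterminal hr ?_ ih₁ ih₂
        simpa [Z, inputs] using ⟨⟨r, hr, rfl⟩, not_not.1 hA.2⟩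
    have := hB Z rfl (fun A hA => (Finset.mem_filter.1 hA).2) _ _ hZ
    simp at this
    omega
  · obtain ⟨i, hi⟩ := Finset.dvd_prod_of_mem per (Finset.mem_image_of_mem _ hr : r.input ∈ inputs)
    have hm' := YieldsLength.nonterminal_singleton (Z := Set.univ) hr trivial
      (hm.mono (Set.subset_univ _))
    have := hk _ ((hper _ hW).mul i m hm')
    rwa [← hi, add_comm _ m, ← add_assoc] at this

end ContextFreeGrammar

/-- A set of numbers that is eventually closed under addition of `P > 0` is eventually periodic. -/
lemma exists_forall_ge_mem_iff_of_period {S : Set ℕ} {P B : ℕ} (hP : 0 < P)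
    (h : ∀ n > B, n ∈ S → n + P ∈ S) : ∃ N, ∀ n ≥ N, n ∈ S ↔ n + P ∈ S := by
  -- `F i` is the trace of `S` on the `i`-th block of `P` numbers beyond `B`; these traces increase
  -- inside a finite lattice, so they stabilize.
  let F : ℕ →o Set (Fin P) :=
    ⟨fun i => {j | B + 1 + i * P + j ∈ S}, monotone_nat_of_le_succ fun i j hj => by
      have := h _ (by omega) hj
      rwa [show B + 1 + i * P + j + P = B + 1 + (i + 1) * P + j by ring] at this⟩
  obtain ⟨N, hN⟩ := WellFoundedGT.monotone_chain_condition F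
  refine ⟨B + 1 + N * P, fun n hn => ⟨h n (by omega), fun hn' => ?_⟩⟩
  obtain ⟨t, rfl⟩ := Nat.exists_eq_add_of_le hn
  have key (i : ℕ) : B + 1 + N * P + t + i * P = B + 1 + (N + t / P + i) * P + t % P := by
    have := Nat.div_add_mod t P
    nlinarith
  have h₀ : F (N + t / P) = F (N + t / P + 1) :=
    (hN _ (Nat.le_add_right _ _)).symm.trans (hN _ ((Nat.le_add_right _ _).trans (Nat.le_succ _)))
  have h₁ : (⟨t % P, Nat.mod_lt _ hP⟩ : Fin P) ∈ F (N + t / P + 1) := by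
    have := key 1
    rw [one_mul] at this
    rw [this] at hn'
    exact hn'
  rw [← h₀] at h₁
  have := key 0
  rw [zero_mul, add_zero, add_zero] at this
  rw [this]
  exact h₁

/-- The words whose length lies in an eventually periodic set form a regular language. -/
lemma Language.isRegular_of_period {T : Type*} {L : Language T} {S : Set ℕ}
    (hL : ∀ w, w ∈ L ↔ w.length ∈ S) {P N : ℕ} (hP : 0 < P)
    (h : ∀ n ≥ N, n ∈ S ↔ n + P ∈ S) : L.IsRegular := by
  refine .of_finite_range_leftQuotient ?_
  -- The left quotient by a word depends only on its length, and beyond `N` only modulo `P`.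
  let Q : ℕ → Language T := fun n => {y | n + y.length ∈ S}
  have hshift (n : ℕ) (hn : N ≤ n) : Q (n + P) = Q n := by
    ext y
    have := h (n + y.length) (by omega)
    rw [add_right_comm] at this
    exact this.symm
  have hlt (n : ℕ) : ∃ m < N + P, Q m = Q n := by
    induction n using Nat.strong_induction_on with
    | _ n ih =>
      by_cases hn : n < N + P
      · exact ⟨n, hn, rfl⟩
      · obtain ⟨m, hm, hQ⟩ := ih (n - P) (by omega)
        refine ⟨m, hm, hQ.trans ?_⟩
        rw [← hshift (n - P) (by omega), Nat.sub_add_cancel (by omega)]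
  refine ((Set.finite_lt_nat (N + P)).image Q).subset ?_
  rintro _ ⟨x, rfl⟩
  obtain ⟨m, hm, hQ⟩ := hlt x.length
  refine ⟨m, hm, hQ.trans ?_⟩
  ext y
  rw [Language.mem_leftQuotient, hL, List.length_append]
  rfl

/-- A context-free language over an alphabet with at most one letter is regular. -/
theorem Language.IsContextFree.isRegular_of_subsingleton {T : Type*} [Subsingleton T]
    {L : Language T} (h : L.IsContextFree) : L.IsRegular := by
  obtain ⟨g, rfl⟩ := h
  obtain ⟨P, hP, B, hB⟩ := g.exists_period
  obtain ⟨N, hN⟩ := exists_forall_ge_mem_iff_of_period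
    (S := {n | ∃ w ∈ g.language, w.length = n}) hP hB
  refine isRegular_of_period (S := {n | ∃ w ∈ g.language, w.length = n})
    (fun w => ⟨fun hw => ⟨w, hw, rfl⟩, ?_⟩) hP hN
  rintro ⟨v, hv, hlen⟩
  rwa [← List.ext_getElem hlen fun _ _ _ => Subsingleton.elim _ _]

/-! ### Embeddings of groups -/

namespace GroupAutomaton

/-- The image of an automaton under a group homomorphism. -/
noncomputable def map {A G H : Type} [Group G] [Group H] (f : G →* H) (E : GroupAutomaton A G) :
    GroupAutomaton A H where
  Q := E.Q
  finite_Q := E.finite_Q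
  step q σ := by
    classical
    exact (E.step q σ).image (Prod.map id f)
  start := E.start
  accept := E.accept

variable {A G H : Type} [Group G] [Group H] {f : G →* H} {E : GroupAutomaton A G}

lemma mem_map_step {q : E.Q} {σ : Option A} {y : E.Q × H} :
    y ∈ (E.map f).step q σ ↔ ∃ x ∈ E.step q σ, Prod.map id f x = y := by
  classical
  exact Finset.mem_image

lemma Run.map {q q' : E.Q} {w : List A} {g : G} (h : E.Run q w g q') :
    (E.map f).Run q w (f g) q' := by
  induction h with
  | nil q => rw [map_one]; exact .nil (E := E.map f) q
  | eps hs _ ih =>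
    rw [map_mul]
    exact .eps (E := E.map f) (mem_map_step.2 ⟨_, hs, rfl⟩) ih
  | read a hs _ ih =>
    rw [map_mul]
    exact .read (E := E.map f) a (mem_map_step.2 ⟨_, hs, rfl⟩) ih

lemma Run.exists_of_map {q q' : (E.map f).Q} {w : List A} {h : H} (hr : (E.map f).Run q w h q') :
    ∃ g, f g = h ∧ E.Run q w g q' := by
  induction hr with
  | nil q => exact ⟨1, map_one f, .nil (E := E) q⟩
  | eps hs _ ih =>
    obtain ⟨g, rfl, hg⟩ := ih
    obtain ⟨⟨p, x⟩, hx, hp⟩ := mem_map_step.1 hs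
    obtain ⟨rfl, rfl⟩ := Prod.mk.inj hp
    exact ⟨x * g, map_mul f x g, .eps hx hg⟩
  | read a hs _ ih =>
    obtain ⟨g, rfl, hg⟩ := ih
    obtain ⟨⟨p, x⟩, hx, hp⟩ := mem_map_step.1 hs
    obtain ⟨rfl, rfl⟩ := Prod.mk.inj hp
    exact ⟨x * g, map_mul f x g, .read a hx hg⟩

lemma language_map (hf : Function.Injective f) : (E.map f).language = E.language := by
  ext w
  rw [mem_language_iff_run, mem_language_iff_run]
  refine exists_congr fun q => and_congr_right fun _ => ⟨fun h => ?_, fun h => ?_⟩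
  · obtain ⟨g, hg, hrun⟩ := h.exists_of_map
    obtain rfl : g = 1 := hf (hg.trans (map_one f).symm)
    exact hrun
  · rw [← map_one f]
    exact h.map

end GroupAutomaton

/-- Language classes are monotone under embeddings of groups. -/
lemma languageClass_subset_of_injective {G H : Type} [Group G] [Group H] {f : G →* H}
    (hf : Function.Injective f) : languageClass G ⊆ languageClass H := by
  rintro L ⟨E, hE⟩
  exact ⟨E.map f, (GroupAutomaton.language_map hf).trans hE⟩

/-! ### The `SL(2,ℚ)`-automaton for `UPOWodd` -/

namespace UPOWodd

open GroupAutomaton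

/-- The lower triangular matrix with first column `(x, y)`. -/
def lowerTri (x y : ℚ) (hx : x ≠ 0) : SLTwoRat :=
  ⟨!![x, 0; y, x⁻¹], by simp [Matrix.det_fin_two_of, hx]⟩

lemma lowerTri_mul {x y x' y' : ℚ} (hx : x ≠ 0) (hx' : x' ≠ 0) :
    lowerTri x y hx * lowerTri x' y' hx' =
      lowerTri (x * x') (y * x' + x⁻¹ * y') (mul_ne_zero hx hx') := by
  refine Subtype.ext ?_
  change !![x, 0; y, x⁻¹] * !![x', 0; y', x'⁻¹] = !![x * x', 0; y * x' + x⁻¹ * y', (x * x')⁻¹]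
  simp [mul_comm]

lemma lowerTri_eq_one_iff {x y : ℚ} (hx : x ≠ 0) : lowerTri x y hx = 1 ↔ x = 1 ∧ y = 0 := by
  constructor
  · intro h
    exact ⟨congrFun (congrFun (congrArg Subtype.val h) 0) 0,
      congrFun (congrFun (congrArg Subtype.val h) 1) 0⟩
  · rintro ⟨rfl, rfl⟩
    refine Subtype.ext ?_
    ext i j
    fin_cases i <;> fin_cases j <;> simp [lowerTri]

lemma A₁_eq : A₁ = lowerTri 2 1 two_ne_zero :=
  Subtype.ext (by simp [A₁, lowerTri])

lemma A₂_pow (m : ℕ) : A₂ ^ m = lowerTri (2 ^ m) 0 (by positivity) := by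
  induction m with
  | zero => simpa using ((lowerTri_eq_one_iff one_ne_zero).2 ⟨rfl, rfl⟩).symm
  | succ m ih =>
    have : A₂ = lowerTri 2 0 two_ne_zero := Subtype.ext (by simp [A₂, lowerTri])
    rw [pow_succ, ih, this, lowerTri_mul]
    congr 1
    · rw [pow_succ]
    · simp

lemma A₃_pow (k : ℕ) : A₃ ^ k = lowerTri 1 (-k) one_ne_zero := by
  induction k with
  | zero => simpa using ((lowerTri_eq_one_iff one_ne_zero).2 ⟨rfl, rfl⟩).symm
  | succ k ih =>
    have : A₃ = lowerTri 1 (-1) one_ne_zero := Subtype.ext (by simp [A₃, lowerTri])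
    rw [pow_succ, ih, this, lowerTri_mul]
    congr 1
    · simp
    · push_cast; ring

lemma A₄_pow (j : ℕ) : A₄ ^ j = lowerTri ((2 ^ j)⁻¹) 0 (by positivity) := by
  induction j with
  | zero => simpa using ((lowerTri_eq_one_iff one_ne_zero).2 ⟨rfl, rfl⟩).symm
  | succ j ih =>
    have : A₄ = lowerTri 2⁻¹ 0 (by norm_num) := Subtype.ext (by simp [A₄, lowerTri])
    rw [pow_succ, ih, this, lowerTri_mul]
    congr 1
    · rw [pow_succ, mul_inv]
    · simp

/-- The upper left entry is `2 ^ (m + 1 - j)`, and the lower left one is `2 ^ (-j) * (2 ^ m - k * 2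
^ (-m - 1))`, which vanishes exactly when `k = 2 ^ (2 * m + 1)`. -/
lemma register_eq_one_iff (m k j : ℕ) :
    A₁ * (A₂ ^ m * (A₃ ^ k * A₄ ^ j)) = 1 ↔ j = m + 1 ∧ k = 2 ^ (2 * m + 1) := by
  rw [A₁_eq, A₂_pow, A₃_pow, A₄_pow, lowerTri_mul, lowerTri_mul, lowerTri_mul, lowerTri_eq_one_iff]
  have hm : (2 : ℚ) ^ m ≠ 0 := by positivity
  have hj : (2 : ℚ) ^ j ≠ 0 := by positivity
  refine and_congr ?_ ?_
  · rw [one_mul, ← mul_assoc, ← pow_succ', mul_inv_eq_one₀ hj]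
    exact ⟨fun h => (pow_right_injective₀ (by norm_num) (by norm_num) h).symm, fun h => h ▸ rfl⟩
  · rw [← @Nat.cast_inj ℚ, Nat.cast_pow, Nat.cast_ofNat, pow_succ, pow_mul', pow_two]
    field_simp
    constructor <;> intro h <;> linarith

/-- The inputs and register changes of the computations that lead from a state to the accept
state. -/
def Reaches : Fin 5 → List Unit → SLTwoRat → Prop
  | 0, w, g => ∃ m k j : ℕ, w = List.replicate k () ∧ g = A₁ * (A₂ ^ m * (A₃ ^ k * A₄ ^ j))
  | 1, w, g => ∃ m k j : ℕ, w = List.replicate k () ∧ g = A₂ ^ m * (A₃ ^ k * A₄ ^ j)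
  | 2, w, g => ∃ k j : ℕ, w = List.replicate k () ∧ g = A₃ ^ k * A₄ ^ j
  | 3, w, g => ∃ j : ℕ, w = [] ∧ g = A₄ ^ j
  | 4, w, g => w = [] ∧ g = 1

/-- Going backwards from the accept state, a loop raises an exponent by one, and entering the next
state without looping sets it to 0. -/
lemma reaches_of_run {q q' : automaton.Q} {w : List Unit} {g : SLTwoRat}
    (h : automaton.Run q w g q') (hq' : q' = (4 : Fin 5)) : Reaches q w g := by
  induction h with
  | nil q => subst hq'; exact ⟨rfl, rfl⟩
  | @eps q p q' x g w hs _ ih =>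
    replace ih := ih hq'
    change Fin 5 at q p
    change (p, x) ∈ delta q none at hs
    fin_cases q <;> simp [delta] at hs
    · obtain ⟨rfl, rfl⟩ := hs
      obtain ⟨m, k, j, rfl, rfl⟩ := ih
      exact ⟨m, k, j, rfl, rfl⟩
    · rcases hs with ⟨rfl, rfl⟩ | ⟨rfl, rfl⟩
      · obtain ⟨m, k, j, rfl, rfl⟩ := ih
        exact ⟨m + 1, k, j, rfl, by rw [pow_succ', mul_assoc]⟩
      · obtain ⟨k, j, rfl, rfl⟩ := ih
        exact ⟨0, k, j, rfl, by simp⟩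
    · obtain ⟨rfl, rfl⟩ := hs
      obtain ⟨j, rfl, rfl⟩ := ih
      exact ⟨0, j, rfl, by simp⟩
    · rcases hs with ⟨rfl, rfl⟩ | ⟨rfl, rfl⟩
      · obtain ⟨j, rfl, rfl⟩ := ih
        exact ⟨j + 1, rfl, by rw [pow_succ']⟩
      · obtain ⟨rfl, rfl⟩ := ih
        exact ⟨0, rfl, by simp⟩
  | @read q p q' x g w a hs _ ih =>
    replace ih := ih hq'
    change Fin 5 at q p
    change (p, x) ∈ delta q (some a) at hs
    fin_cases q <;> simp [delta] at hs
    obtain ⟨rfl, rfl⟩ := hs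
    obtain ⟨k, j, rfl, rfl⟩ := ih
    exact ⟨k + 1, j, rfl, by rw [pow_succ', mul_assoc]⟩

lemma run_pow_of_eps_loop {q : automaton.Q} {x : SLTwoRat} (h : (q, x) ∈ automaton.step q none)
    (m : ℕ) : automaton.Run q [] (x ^ m) q := by
  induction m with
  | zero => rw [pow_zero]; exact .nil q
  | succ m ih => rw [pow_succ']; exact .eps h ih

lemma run_pow_of_read_loop {q : automaton.Q} {x : SLTwoRat}
    (h : (q, x) ∈ automaton.step q (some ())) (k : ℕ) :
    automaton.Run q (List.replicate k ()) (x ^ k) q := by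
  induction k with
  | zero => rw [pow_zero]; exact .nil q
  | succ k ih => rw [pow_succ']; exact .read () h ih

lemma run_register (m k j : ℕ) :
    automaton.Run (0 : Fin 5) (List.replicate k ()) (A₁ * (A₂ ^ m * (A₃ ^ k * A₄ ^ j)))
      (4 : Fin 5) := by
  have h₀ : ((1 : Fin 5), A₁) ∈ delta 0 none := by simp [delta]
  have h₁ : ((1 : Fin 5), A₂) ∈ delta 1 none := by simp [delta]
  have h₁₂ : ((2 : Fin 5), 1) ∈ delta 1 none := by simp [delta]
  have h₂ : ((2 : Fin 5), A₃) ∈ delta 2 (some ()) := by simp [delta]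
  have h₂₃ : ((3 : Fin 5), 1) ∈ delta 2 none := by simp [delta]
  have h₃ : ((3 : Fin 5), A₄) ∈ delta 3 none := by simp [delta]
  have h₃₄ : ((4 : Fin 5), 1) ∈ delta 3 none := by simp [delta]
  have r₃ := (run_pow_of_eps_loop h₃ j).trans (.eps h₃₄ (.nil (E := automaton) (4 : Fin 5)))
  have r₂ := (run_pow_of_read_loop h₂ k).trans (.eps h₂₃ r₃)
  have r₁ := (run_pow_of_eps_loop h₁ m).trans (.eps h₁₂ r₂)
  simpa [mul_assoc] using Run.eps (E := automaton) h₀ r₁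

theorem language_automaton : automaton.language = UPOWodd := by
  ext w
  rw [mem_language_iff_run]
  constructor
  · rintro ⟨q, hq, h⟩
    obtain ⟨m, k, j, rfl, hg⟩ := reaches_of_run h hq
    obtain ⟨-, rfl⟩ := (register_eq_one_iff m k j).1 hg.symm
    exact ⟨m, rfl⟩
  · rintro ⟨m, rfl⟩
    refine ⟨(4 : Fin 5), rfl, ?_⟩
    rw [← (register_eq_one_iff m _ (m + 1)).2 ⟨rfl, rfl⟩]
    exact run_register m _ _

end UPOWodd

/-! ### Non-regularity and conclusion -/

lemma UPOWodd.not_isRegular : ¬ UPOWodd.IsRegular := by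
  intro h
  have hinj : Function.Injective fun n : ℕ =>
      UPOWodd.leftQuotient (List.replicate (2 ^ (2 * n + 1)) ()) := by
    have hlt (i j : ℕ) (hij : i < j) :
        UPOWodd.leftQuotient (List.replicate (2 ^ (2 * i + 1)) ()) ≠
          UPOWodd.leftQuotient (List.replicate (2 ^ (2 * j + 1)) ()) := by
      intro he
      -- This suffix completes `2 ^ (2 * i + 1)` to the next odd power `2 ^ (2 * i + 3)`, but for `j
      -- > i` it leads strictly between `2 ^ (2 * j + 1)` and `2 ^ (2 * j + 3)`.
      have hi : List.replicate (3 * 2 ^ (2 * i + 1)) () ∈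
          UPOWodd.leftQuotient (List.replicate (2 ^ (2 * i + 1)) ()) := by
        rw [Language.mem_leftQuotient, ← List.replicate_add]
        exact ⟨i + 1, by congr 1; ring⟩
      rw [he, Language.mem_leftQuotient, ← List.replicate_add] at hi
      obtain ⟨n, hn⟩ := hi
      have hn := congrArg List.length hn
      rw [List.length_replicate, List.length_replicate] at hn
      have hij' : 2 ^ (2 * i + 1) < 2 ^ (2 * j + 1) := Nat.pow_lt_pow_right (by norm_num) (by omega)
      have hpos : 0 < 2 ^ (2 * i + 1) := by positivity
      have h₁ : 2 * j + 1 < 2 * n + 1 :=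
        (Nat.pow_lt_pow_iff_right (a := 2) (by norm_num)).1 (by omega)
      have h₂ : 2 * n + 1 < 2 * j + 1 + 2 :=
        (Nat.pow_lt_pow_iff_right (a := 2) (by norm_num)).1 (by rw [pow_add _ (2 * j + 1)]; omega)
      omega
    intro i j he
    rcases lt_trichotomy i j with hij | hij | hij
    · exact absurd he (hlt i j hij)
    · exact hij
    · exact absurd he.symm (hlt j i hij)
  refine Set.infinite_range_of_injective hinj (h.finite_range_leftQuotient.subset ?_)
  rintro _ ⟨n, rfl⟩
  exact ⟨_, rfl⟩

theorem mainTheorem2 :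
    languageClass SLTwoInt ⊂ languageClass SLTwoRat ∧
    UPOWodd.automaton.language = UPOWodd ∧
    ¬ UPOWodd.IsRegular ∧
    languageClass SLTwoInt = contextFreeClass ∧
    (∀ L ∈ languageClass SLTwoInt, Nat.card L.alphabet = 1 → L.words.IsRegular) := by
  have hCF : languageClass SLTwoInt = contextFreeClass :=
    languageClass_SLTwoInt_subset_contextFreeClass.antisymm
      contextFreeClass_subset_languageClass_SLTwoInt
  have hreg (L : FormalLanguage) (hL : L ∈ languageClass SLTwoInt) (h1 : Nat.card L.alphabet = 1) :
      L.words.IsRegular := by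
    have := (Nat.card_eq_one_iff_unique.1 h1).1
    rw [hCF] at hL
    exact Language.IsContextFree.isRegular_of_subsingleton hL
  refine ⟨⟨languageClass_subset_of_injective
    (f := Matrix.SpecialLinearGroup.map (Int.castRingHom ℚ)) ?_, fun h => ?_⟩, UPOWodd.language_automaton, UPOWodd.not_isRegular, hCF, hreg⟩
  · exact Matrix.SpecialLinearGroup.map_intCast_injective
  · exact UPOWodd.not_isRegular (hreg ⟨Unit, inferInstance, UPOWodd⟩
      (h ⟨UPOWodd.automaton, UPOWodd.language_automaton⟩) (by simp))
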